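/- Let $\widehat G$ be a finite group, $G\unlhd\widehat G$ a normal subgroup with $\widehat G/G$ cyclic, $\ell$ a prime not dividing $|\widehat G:G|$, and $P$ a Sylow $\ell$-subgroup of $G$ such that $\widehat G = G\,C_{\widehat G}(P)$. Let $\chi$ be an irreducible complex character of $G$ lying in the principal $\ell$-block of $G$; that is, for a fixed maximal ideal $M$ containing $\ell$ of the ring of algebraic integers in $\mathbb{C}$, one has $$\frac{|K|\,\chi(g)}{\chi(1)}\equiv |K| \pmod M$$ for every $g\in G$, where $K$ denotes the conjugacy class of $g$ in $G$. Then there is an irreducible complex character $\widehat\chi$ of $\widehat G$ with $\widehat\chi|_G=\chi$ and $\mathbb{Q}(\widehat\chi)=\mathbb{Q}(\chi)$, where $\mathbb{Q}(\chi)$ denotes the subfield of $\mathbb{C}$ generated over $\mathbb{Q}$ by the values of $\chi$. -/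

import Mathlib

open scoped Pointwise

noncomputable section

/-- `χ` is an irreducible complex character of `G`: the character of an irreducible
finite-dimensional complex representation (written on some `ℂⁿ`). -/
def IsIrrChar {G : Type*} [Group G] (χ : G → ℂ) : Prop :=
  ∃ (n : ℕ) (ρ : Representation ℂ G (Fin n → ℂ)), ρ.IsIrreducible ∧ χ = ρ.character

/-- The value `ω_χ(K⁺) = |K| χ(g) / χ(1)` of the central character of `χ` at the sum of the
conjugacy class `K` of `g`. -/
def centralCharValue {G : Type*} [Group G] (χ : G → ℂ) (g : G) : ℂ :=
  (Nat.card (conjugatesOf g) : ℂ) * χ g / χ 1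

/-- Two irreducible characters lie in the same `ℓ`-block, where `M` is a maximal ideal containing
`ℓ` of the ring of all algebraic integers in `ℂ`: their central characters agree modulo `M`. -/
def SameBlock {G : Type*} [Group G] (M : Ideal (integralClosure ℤ ℂ)) (χ ψ : G → ℂ) : Prop :=
  ∀ g : G, ∃ m ∈ M, centralCharValue χ g - centralCharValue ψ g = (m : ℂ)

/-- The irreducible characters in the principal `ℓ`-block, the block that contains the trivial
character. -/
def InPrincipalBlock {G : Type*} [Group G] (M : Ideal (integralClosure ℤ ℂ)) (χ : G → ℂ) : Prop :=
  IsIrrChar χ ∧ SameBlock M χ (fun _ => 1)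

/-- The character field `ℚ(χ)`, generated by the values of `χ`. -/
def characterField {G : Type*} (χ : G → ℂ) : IntermediateField ℚ ℂ :=
  IntermediateField.adjoin ℚ (Set.range χ)

end

/-! Write `Ghat = G C(P)` and pick `c ∈ C(P)` whose coset generates `Ghat/G`, of order `m`. Since
`c` centralizes `P`, its class size `k` in `Ghat` is prime to `ℓ`. The class sum `z` of `c` is
central and lies in a single coset, so `z ^ m` is supported on `G` and acts on `ρ` as a scalar,
congruent to `k ^ m` modulo `M` by the block hypothesis. This scalar has an `m`-th root `ζ`
congruent to `k`. Each nonzero root gives an extension `σ` of `ρ` on which `z` acts as `ζ`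
(`exists_extension`); this `ζ` puts the extension in the principal block.

For the field, let `τ` fix `ℚ(χ)`. It sends `ζ` to the central character value `η` of `σ` at a class
of the same size `k`, so `η` is congruent to `k`, hence to `ζ`. Also `η ^ m = ζ ^ m`, because `ζ ^
m` lies in `ℚ(χ)`. As `m` and `k` are nonzero modulo `M`, congruent roots coincide: `η = ζ`. Thus `ζ
∈ ℚ(χ)`, and multiplying `h` by a power of `z` moves it into the group ring of `G`, which puts every
value of the extended character in `ℚ(χ)`. -/

open MonoidAlgebra

/-! ### Central elements and coset supports in the integral group ring -/

section GroupAlgebra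

variable {H : Type*} [Group H]

/-- The support of the group ring element `u` lies in the coset `t` of `N`. -/
def SupportedOnCoset {N : Subgroup H} (t : H ⧸ N) (u : MonoidAlgebra ℤ H) : Prop :=
  ∀ h, u.coeff h ≠ 0 → (h : H ⧸ N) = t

namespace SupportedOnCoset

variable {N : Subgroup H}

theorem single (h : H) (a : ℤ) : SupportedOnCoset (h : H ⧸ N) (MonoidAlgebra.single h a) := by
  classical
  intro x hx
  by_contra hne
  apply hx
  rw [coeff_single, Finsupp.single_apply, if_neg]
  rintro rfl
  exact hne rfl

variable [N.Normal]

theorem mul {t s : H ⧸ N} {u v : MonoidAlgebra ℤ H} (hu : SupportedOnCoset t u)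
    (hv : SupportedOnCoset s v) : SupportedOnCoset (t * s) (u * v) := by
  classical
  intro h hh
  obtain ⟨a, ha, b, hb, rfl⟩ := Finset.mem_mul.mp
    (support_coeff_mul_subset u v (Finsupp.mem_support_iff.mpr hh))
  rw [QuotientGroup.mk_mul, hu a (Finsupp.mem_support_iff.mp ha),
    hv b (Finsupp.mem_support_iff.mp hb)]

theorem pow {t : H ⧸ N} {u : MonoidAlgebra ℤ H} (hu : SupportedOnCoset t u) (i : ℕ) :
    SupportedOnCoset (t ^ i) (u ^ i) := by
  induction i with
  | zero => simpa [MonoidAlgebra.one_def] using SupportedOnCoset.single (N := N) 1 1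
  | succ i ih => simpa only [pow_succ] using ih.mul hu

end SupportedOnCoset

theorem coeff_conj_of_mem_center {u : MonoidAlgebra ℤ H} (hu : u ∈ Subring.center _) (h x : H) :
    u.coeff (h * x * h⁻¹) = u.coeff x := by
  have := congrArg (fun v => v.coeff (h * x)) (Subring.mem_center_iff.mp hu (single h 1))
  simpa [mul_assoc] using this.symm

theorem mem_center_of_coeff_conj {u : MonoidAlgebra ℤ H}
    (hu : ∀ h x, u.coeff (h * x * h⁻¹) = u.coeff x) : u ∈ Subring.center _ := by
  rw [Subring.mem_center_iff]
  intro v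
  induction v using MonoidAlgebra.induction_linear with
  | zero => simp
  | add v w hv hw => rw [add_mul, mul_add, hv, hw]
  | single h a =>
    ext x
    simp only [coeff_single_mul_apply, coeff_mul_single_apply]
    rw [mul_comm a, ← hu h (h⁻¹ * x)]
    simp

variable [Fintype H]

theorem lift_eq_sum {B : Type*} [Ring B] (ρ : H →* B) (u : MonoidAlgebra ℤ H) :
    MonoidAlgebra.lift ℤ B H ρ u = ∑ h, u.coeff h • ρ h := by
  rw [lift_apply, Finsupp.sum_fintype]
  simp

theorem sum_eq_sum_subgroup {B : Type*} [AddCommGroup B] (N : Subgroup H) [N.Normal] [Fintype N]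
    {u : MonoidAlgebra ℤ H} (hu : SupportedOnCoset (1 : H ⧸ N) u) (f : H → B) :
    ∑ h, u.coeff h • f h = ∑ g : N, u.coeff (g : H) • f g := by
  refine (Fintype.sum_of_injective (Subtype.val : N → H) Subtype.val_injective _ _ ?_
    fun _ => rfl).symm
  intro h hh
  rw [Subtype.range_coe] at hh
  by_cases h0 : u.coeff h = 0
  · rw [h0, zero_smul]
  · exact absurd ((QuotientGroup.eq_one_iff h).mp (hu h h0)) hh

/-- The augmentation of the integral group ring. -/
noncomputable def augmentation (H : Type*) [Group H] : MonoidAlgebra ℤ H →ₐ[ℤ] ℤ :=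
  MonoidAlgebra.lift ℤ ℤ H 1

theorem augmentation_eq_sum (u : MonoidAlgebra ℤ H) : augmentation H u = ∑ h, u.coeff h := by
  simp [augmentation, lift_eq_sum]

open Classical in
/-- The sum of the conjugacy class of `c` in the integral group ring. -/
noncomputable def classSum (c : H) : MonoidAlgebra ℤ H :=
  MonoidAlgebra.ofCoeff (Finsupp.equivFunOnFinite.symm (fun h => if h ∈ conjugatesOf c then 1 else 0))

open Classical in
theorem coeff_classSum (c h : H) :
    (classSum c).coeff h = if h ∈ conjugatesOf c then 1 else 0 := by
  simp [classSum]

theorem classSum_mem_center (c : H) : classSum c ∈ Subring.center (MonoidAlgebra ℤ H) := by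
  classical
  refine mem_center_of_coeff_conj fun h x => ?_
  have : h * x * h⁻¹ ∈ conjugatesOf c ↔ x ∈ conjugatesOf c := by
    change IsConj c _ ↔ IsConj c x
    have hx : IsConj x (h * x * h⁻¹) := isConj_iff.mpr ⟨h, rfl⟩
    exact ⟨fun H => H.trans hx.symm, fun H => H.trans hx⟩
  simp only [coeff_classSum, this]

theorem sum_classSum {B : Type*} [AddCommGroup B] (c : H) (f : H → B)
    (hf : ∀ h x, f (h * x * h⁻¹) = f x) :
    ∑ h, (classSum c).coeff h • f h = Nat.card (conjugatesOf c) • f c := by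
  classical
  simp only [coeff_classSum, ite_smul, one_smul, zero_smul]
  rw [← Finset.sum_filter, Finset.sum_congr rfl (g := fun _ => f c), Finset.sum_const,
    Nat.card_eq_fintype_card, Fintype.card_subtype]
  intro x hx
  obtain ⟨y, rfl⟩ := isConj_iff.mp (show IsConj c x from (Finset.mem_filter.mp hx).2)
  exact hf y c

theorem augmentation_classSum (c : H) :
    augmentation H (classSum c) = Nat.card (conjugatesOf c) := by
  rw [augmentation_eq_sum]
  simpa using sum_classSum c (fun _ => (1 : ℤ)) (by simp)

/-- The quotient is abelian, so conjugate elements have the same image in it. -/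
theorem supportedOnCoset_classSum {N : Subgroup H} [N.Normal] [IsCyclic (H ⧸ N)] (c : H) :
    SupportedOnCoset (c : H ⧸ N) (classSum c) := by
  classical
  intro x hx
  rw [coeff_classSum] at hx
  have hx' : x ∈ conjugatesOf c := by by_contra h; simp [h] at hx
  obtain ⟨y, rfl⟩ := isConj_iff.mp (show IsConj c x from hx')
  let _ := IsCyclic.commGroup (α := H ⧸ N)
  rw [QuotientGroup.mk_mul, QuotientGroup.mk_mul, QuotientGroup.mk_inv]
  exact mul_inv_cancel_comm (y : H ⧸ N) (c : H ⧸ N)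

end GroupAlgebra

/-! ### Traces of powers of an operator of finite order -/

section Trace

/-- `X ^ N - 1` is separable, so `T` is diagonalizable. The same eigenvalues and multiplicities
serve every `k`, which lets Galois action be compared with taking powers. -/
theorem exists_trace_pow_eq_sum {V : Type*} [AddCommGroup V] [Module ℂ V] [FiniteDimensional ℂ V]
    {T : Module.End ℂ V} {N : ℕ} (hN : N ≠ 0) (hT : T ^ N = 1) :
    ∃ (s : Finset ℂ) (d : ℂ → ℕ), (∀ x ∈ s, x ^ N = 1) ∧
      ∀ k : ℕ, LinearMap.trace ℂ V (T ^ k) = ∑ x ∈ s, d x * x ^ k := by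
  have hss : T.IsSemisimple := by
    refine Module.End.isSemisimple_of_squarefree_aeval_eq_zero
      (p := (Polynomial.X ^ N - 1 : Polynomial ℂ)) ?_ (by simp [hT])
    exact (Polynomial.separable_X_pow_sub_C (1 : ℂ) (by simpa using hN) one_ne_zero).squarefree
  have hind := T.eigenspaces_iSupIndep
  have hfin : {x | T.eigenspace x ≠ ⊥}.Finite := WellFoundedGT.finite_ne_bot_of_iSupIndep hind
  have hint : DirectSum.IsInternal (fun x => T.eigenspace x) :=
    DirectSum.isInternal_submodule_of_iSupIndep_of_iSup_eq_top hind hss.iSup_eigenspace_eq_top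
  have hpow : ∀ (k : ℕ) (x : ℂ) (v : V), v ∈ T.eigenspace x → (T ^ k) v = x ^ k • v := by
    intro k x v hv
    induction k with
    | zero => simp
    | succ k ih =>
      rw [pow_succ', Module.End.mul_apply, ih, map_smul, Module.End.mem_eigenspace_iff.mp hv,
        smul_smul, pow_succ]
  refine ⟨hfin.toFinset, fun x => Module.finrank ℂ (T.eigenspace x), ?_, fun k => ?_⟩
  · intro x hx
    obtain ⟨v, hv, hv0⟩ := Submodule.exists_mem_ne_zero_of_ne_bot (hfin.mem_toFinset.mp hx)
    have := hpow N x v hv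
    rw [hT, Module.End.one_apply] at this
    exact (smul_left_injective ℂ hv0 (by simpa using this)).symm
  · have hmap : ∀ x, Set.MapsTo (T ^ k) (T.eigenspace x) (T.eigenspace x) := by
      intro x v hv
      rw [hpow k x v hv]
      exact Submodule.smul_mem _ _ hv
    rw [LinearMap.trace_eq_sum_trace_restrict' hint hfin hmap]
    refine Finset.sum_congr rfl fun x _ => ?_
    have : (T ^ k).restrict (hmap x) = x ^ k • LinearMap.id := by
      ext v
      exact hpow k x v v.2
    rw [this, map_smul, LinearMap.trace_id, smul_eq_mul, mul_comm]

end Trace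

/-! ### Central characters and the principal block -/

section CentralCharacter

variable {H V : Type*} [Group H] [AddCommGroup V] [Module ℂ V] [FiniteDimensional ℂ V]

theorem exists_eq_smul_one_of_commute (ρ : Representation ℂ H V) [ρ.IsIrreducible]
    {T : Module.End ℂ V} (hT : ∀ h, Commute T (ρ h)) : ∃ s : ℂ, T = s • 1 := by
  obtain ⟨s, hs⟩ :=
    (Representation.IsIrreducible.algebraMap_intertwiningMap_bijective_of_isAlgClosed
      (ρ := ρ)).2 ⟨T, fun h => hT h⟩
  refine ⟨s, ?_⟩
  have := congrArg Representation.IntertwiningMap.toLinearMap hs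
  exact this.symm

theorem exists_lift_eq_smul_one (ρ : Representation ℂ H V) [ρ.IsIrreducible]
    {u : MonoidAlgebra ℤ H} (hu : u ∈ Subring.center _) :
    ∃ s : ℂ, MonoidAlgebra.lift ℤ (Module.End ℂ V) H ρ u = s • 1 := by
  refine exists_eq_smul_one_of_commute ρ fun h => ?_
  have := congrArg (MonoidAlgebra.lift ℤ (Module.End ℂ V) H ρ)
    (Subring.mem_center_iff.mp hu (MonoidAlgebra.single h 1))
  rw [commute_iff_eq]
  simpa [map_mul] using this.symm

theorem finrank_ne_zero_of_isIrreducible (ρ : Representation ℂ H V) [ρ.IsIrreducible] :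
    (Module.finrank ℂ V : ℂ) ≠ 0 := by
  rw [Nat.cast_ne_zero]
  intro h
  have := Module.finrank_zero_iff.mp h
  refine bot_ne_top (α := Subrepresentation ρ) ?_
  apply Subrepresentation.toSubmodule_injective
  exact Subsingleton.elim _ _

theorem centralChar_mul_finrank [Fintype H] (ρ : Representation ℂ H V) {c : H} {s : ℂ}
    (hs : MonoidAlgebra.lift ℤ (Module.End ℂ V) H ρ (classSum c) = s • 1) :
    s * Module.finrank ℂ V = Nat.card (conjugatesOf c) * ρ.character c := by
  have := congrArg (LinearMap.trace ℂ V) hs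
  rw [lift_eq_sum, map_sum, map_smul, LinearMap.trace_one, smul_eq_mul] at this
  rw [← this]
  simp only [map_zsmul]
  rw [sum_classSum c (fun h => LinearMap.trace ℂ V (ρ h)) (fun h x => ρ.char_conj x h)]
  rw [nsmul_eq_mul]; rfl

/-- Grouping by conjugacy classes turns the block congruences into one for any integral class
function `w`. -/
theorem exists_sum_div_sub_mem [Fintype H] {M : Ideal (integralClosure ℤ ℂ)} {χ : H → ℂ}
    (hconj : ∀ h x, χ (h * x * h⁻¹) = χ x)
    (hχ : SameBlock M χ (fun _ => 1)) {w : H → ℤ} (hw : ∀ h x, w (h * x * h⁻¹) = w x) :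
    ∃ a ∈ M, (∑ h, (w h : ℂ) * χ h) / χ 1 - ∑ h, (w h : ℂ) = (a : ℂ) := by
  classical
  choose a ha hax using hχ
  have hfib : ∀ (f : H → ℂ), (∀ h x, f (h * x * h⁻¹) = f x) →
      ∑ h, f h = ∑ C : ConjClasses H, Nat.card (conjugatesOf C.out) * f C.out := by
    intro f hf
    rw [← Finset.sum_fiberwise (s := Finset.univ) (g := ConjClasses.mk)]
    refine Finset.sum_congr rfl fun C _ => ?_
    have := sum_classSum C.out f hf
    rw [nsmul_eq_mul] at this
    rw [← this, Finset.sum_filter]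
    refine Finset.sum_congr rfl fun h _ => ?_
    have : ConjClasses.mk h = C ↔ h ∈ conjugatesOf C.out := by
      conv_lhs => rw [← Quotient.out_eq C]
      exact ConjClasses.mk_eq_mk_iff_isConj.trans isConj_comm
    rw [coeff_classSum]
    by_cases hh : h ∈ conjugatesOf C.out
    · rw [if_pos hh, if_pos (this.mpr hh), one_smul]
    · rw [if_neg hh, if_neg (mt this.mp hh), zero_smul]
  refine ⟨∑ C : ConjClasses H, (w C.out : integralClosure ℤ ℂ) * a C.out,
    sum_mem fun C _ => M.mul_mem_left _ (ha _), ?_⟩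
  rw [hfib (fun h => (w h : ℂ) * χ h) (fun h x => by rw [hw, hconj]),
    hfib (fun h => (w h : ℂ)) (fun h x => by rw [hw]), Finset.sum_div, ← Finset.sum_sub_distrib]
  push_cast
  refine Finset.sum_congr rfl fun C _ => ?_
  rw [← hax]
  simp only [centralCharValue]
  ring

/-- The central character of an irreducible character of `N` in the principal block, evaluated at a
central element of the integral group ring of the larger group that is supported on `N`. -/
theorem exists_centralChar_sub_augmentation_mem [Fintype H] (N : Subgroup H) [N.Normal]
    [Fintype N] {M : Ideal (integralClosure ℤ ℂ)} (ρ : Representation ℂ N V) [ρ.IsIrreducible]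
    (hχ : SameBlock M ρ.character (fun _ => 1)) {u : MonoidAlgebra ℤ H}
    (hu : u ∈ Subring.center _) (huN : SupportedOnCoset (1 : H ⧸ N) u) :
    ∃ s : integralClosure ℤ ℂ, (∑ g : N, u.coeff (g : H) • ρ g) = (s : ℂ) • 1 ∧
      (s : ℂ) ∈ characterField ρ.character ∧
      s - (augmentation H u : integralClosure ℤ ℂ) ∈ M := by
  have hw : ∀ h x : N, u.coeff ((h * x * h⁻¹ : N) : H) = u.coeff (x : H) :=
    fun h x => by simpa using coeff_conj_of_mem_center hu (h : H) (x : H)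
  obtain ⟨a, ha, hax⟩ := exists_sum_div_sub_mem (fun h x => ρ.char_conj x h) hχ
    (w := fun g : N => u.coeff (g : H)) hw
  obtain ⟨s, hs⟩ : ∃ s : ℂ, (∑ g : N, u.coeff (g : H) • ρ g) = s • 1 := by
    refine exists_eq_smul_one_of_commute ρ fun h => ?_
    change _ * _ = _ * _
    rw [Finset.sum_mul, Finset.mul_sum]
    refine Fintype.sum_equiv (MulAut.conj h⁻¹).toEquiv _ _ fun g => ?_
    have h1 : u.coeff ((MulAut.conj h⁻¹ g : N) : H) = u.coeff (g : H) := by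
      rw [MulAut.conj_apply]
      exact hw h⁻¹ g
    change _ = _ * (u.coeff ((MulAut.conj h⁻¹ g : N) : H) • ρ (MulAut.conj h⁻¹ g))
    rw [h1, smul_mul_assoc, mul_smul_comm, ← map_mul, ← map_mul, MulAut.conj_apply]
    congr 2
    group
  have hd := finrank_ne_zero_of_isIrreducible ρ
  have hs' : s = (∑ g : N, (u.coeff (g : H) : ℂ) * ρ.character g) / ρ.character 1 := by
    have := congrArg (LinearMap.trace ℂ V) hs
    rw [map_sum, map_smul, LinearMap.trace_one, smul_eq_mul] at this
    rw [ρ.char_one, eq_div_iff hd, ← this]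
    refine Finset.sum_congr rfl fun g _ => ?_
    rw [map_zsmul, zsmul_eq_mul]; rfl
  have haug : (augmentation H u : ℂ) = ∑ g : N, (u.coeff (g : H) : ℂ) := by
    have := sum_eq_sum_subgroup N huN (fun _ => (1 : ℂ))
    simpa [augmentation_eq_sum] using this
  have hsa : s = ((a + (augmentation H u : integralClosure ℤ ℂ) : integralClosure ℤ ℂ) : ℂ) := by
    push_cast
    rw [← hax, ← hs', haug]
    ring
  refine ⟨_, hsa ▸ hs, ?_, by simpa using ha⟩
  rw [← hsa, hs']
  have hmem : ∀ g, ρ.character g ∈ characterField ρ.character :=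
    fun g => IntermediateField.subset_adjoin _ _ ⟨g, rfl⟩
  exact div_mem (sum_mem fun g _ => mul_mem (intCast_mem _ _) (hmem g)) (hmem 1)

end CentralCharacter

/-! ### Roots modulo a prime ideal -/

section Arithmetic

variable {A : Type*} [CommRing A] [IsDomain A] {M : Ideal A} [M.IsPrime]

/-- If `a ≠ b`, the cofactor of `a - b` in `a ^ m - b ^ m` vanishes; modulo `M` it is `m * b ^ (m -
1)`, which is nonzero. -/
theorem eq_of_pow_eq_of_sub_mem {m : ℕ} (hm : (m : A) ∉ M) {a b : A} (hb : b ∉ M)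
    (hab : a - b ∈ M) (hpow : a ^ m = b ^ m) : a = b := by
  have h1 : (∑ i ∈ Finset.range m, a ^ i * b ^ (m - 1 - i)) * (a - b) = 0 := by
    rw [(Commute.all a b).geom_sum₂_mul, hpow, sub_self]
  rcases mul_eq_zero.mp h1 with h | h
  · have h2 := congrArg (Ideal.Quotient.mk M) h
    rw [map_sum] at h2
    simp only [map_mul, map_pow, Ideal.Quotient.eq.mpr hab, map_zero] at h2
    rw [geom_sum₂_self, ← map_natCast (Ideal.Quotient.mk M), ← map_pow, ← map_mul,
      Ideal.Quotient.eq_zero_iff_mem] at h2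
    rcases Ideal.IsPrime.mem_or_mem inferInstance h2 with h | h
    · exact absurd h hm
    · exact absurd (Ideal.IsPrime.mem_of_pow_mem inferInstance _ h) hb
  · exact sub_eq_zero.mp h

/-- For any root `y` of `θ`, `k ^ m - y ^ m` is the product of the `k - ε * y` over `m`-th roots of
unity `ε`; primality of `M` selects a factor. -/
theorem exists_root_sub_mem {M : Ideal (integralClosure ℤ ℂ)} [M.IsPrime] {m : ℕ} (hm : m ≠ 0)
    {θ k : integralClosure ℤ ℂ} (hθ : θ - k ^ m ∈ M) :
    ∃ ζ : integralClosure ℤ ℂ, ζ ^ m = θ ∧ ζ - k ∈ M := by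
  obtain ⟨y, hy⟩ := IsAlgClosed.exists_pow_nat_eq (θ : ℂ) (Nat.pos_of_ne_zero hm)
  have hyi : IsIntegral ℤ y := IsIntegral.of_pow (Nat.pos_of_ne_zero hm) (hy ▸ θ.2)
  have hμ := Complex.isPrimitiveRoot_exp m hm
  have hμi : IsIntegral ℤ (Complex.exp (2 * Real.pi * Complex.I / m)) :=
    hμ.isIntegral (Nat.pos_of_ne_zero hm)
  let y' : integralClosure ℤ ℂ := ⟨y, hyi⟩
  have hy' : y' ^ m = θ := Subtype.ext hy
  have hμ' : IsPrimitiveRoot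
      (⟨Complex.exp (2 * Real.pi * Complex.I / m), hμi⟩ : integralClosure ℤ ℂ) m :=
    IsPrimitiveRoot.of_map_of_injective (f := (integralClosure ℤ ℂ).val) hμ
      Subtype.val_injective
  rw [← hy', ← neg_mem_iff, neg_sub,
    hμ'.pow_sub_pow_eq_prod_sub_mul k y' (Nat.pos_of_ne_zero hm),
    Ideal.IsPrime.prod_mem_iff] at hθ
  obtain ⟨ε, hε, hmem⟩ := hθ
  refine ⟨ε * y', ?_, by rwa [← neg_mem_iff, neg_sub]⟩
  rw [mul_pow, (Polynomial.mem_nthRootsFinset (Nat.pos_of_ne_zero hm) _).mp hε, one_mul, hy']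

end Arithmetic

/-! ### Extending a representation through an eigenspace of the coinduced one -/

section Extension

variable {H V : Type*} [Group H] [AddCommGroup V] [Module ℂ V]

/-- The representation of `H` by right translations on functions `H → V`. -/
def rightTranslation (H V : Type*) [Group H] [AddCommGroup V] [Module ℂ V] :
    Representation ℂ H (H → V) where
  toFun h := LinearMap.funLeft ℂ V (· * h)
  map_one' := by ext; simp [LinearMap.funLeft]
  map_mul' a b := by ext; simp [LinearMap.funLeft, mul_assoc]

theorem rightTranslation_apply (h : H) (f : H → V) (x : H) :
    rightTranslation H V h f x = f (x * h) := rfl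

theorem isIrreducible_of_extension {N : Subgroup H} (ρ : Representation ℂ N V) [ρ.IsIrreducible]
    (σ : Representation ℂ H V) (hσ : ∀ g : N, σ g = ρ g) : σ.IsIrreducible where
  exists_pair_ne := by
    refine ⟨⊥, ⊤, fun h => bot_ne_top (α := Subrepresentation ρ) ?_⟩
    apply Subrepresentation.toSubmodule_injective
    exact congrArg (Subrepresentation.toSubmodule (ρ := σ)) h
  eq_bot_or_eq_top W := by
    let W' : Subrepresentation ρ :=
      ⟨W.toSubmodule, fun g v hv => hσ g ▸ W.apply_mem_toSubmodule (g : H) hv⟩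
    refine (IsSimpleOrder.eq_bot_or_eq_top W').imp (fun h => ?_) (fun h => ?_) <;>
    · apply Subrepresentation.toSubmodule_injective
      exact congrArg (Subrepresentation.toSubmodule (ρ := ρ)) h

variable [Fintype H]

theorem lift_apply_vector {W : Type*} [AddCommGroup W] [Module ℂ W] (τ : Representation ℂ H W)
    (u : MonoidAlgebra ℤ H) (w : W) :
    MonoidAlgebra.lift ℤ (Module.End ℂ W) H τ u w = ∑ h, u.coeff h • τ h w := by
  rw [lift_eq_sum, LinearMap.sum_apply]
  rfl

theorem lift_rightTranslation_apply (u : MonoidAlgebra ℤ H) (f : H → V) (x : H) :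
    MonoidAlgebra.lift ℤ (Module.End ℂ (H → V)) H (rightTranslation H V) u f x =
      ∑ h, u.coeff h • f (x * h) := by
  rw [lift_apply_vector, Finset.sum_apply]
  rfl

/-- The functions `H → V` that are equivariant under `ρ` form the representation coinduced from
`ρ`; this is its subspace on which the group ring element `z` acts as the scalar `ζ`. -/
def coinducedEigenspace {N : Subgroup H} (ρ : Representation ℂ N V) (z : MonoidAlgebra ℤ H)
    (ζ : ℂ) : Submodule ℂ (H → V) where
  carrier := {f | (∀ (g : N) x, f (g * x) = ρ g (f x)) ∧
    MonoidAlgebra.lift ℤ (Module.End ℂ (H → V)) H (rightTranslation H V) z f = ζ • f}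
  zero_mem' := by simp
  add_mem' := by
    rintro f₁ f₂ ⟨h₁, h₁'⟩ ⟨h₂, h₂'⟩
    exact ⟨fun g x => by simp [h₁, h₂], by rw [map_add, h₁', h₂', smul_add]⟩
  smul_mem' := by
    rintro a f ⟨h, h'⟩
    exact ⟨fun g x => by simp [h], by rw [map_smul, h', smul_comm]⟩

theorem lift_rightTranslation_eq_smul {N : Subgroup H} [N.Normal] [Fintype N]
    (ρ : Representation ℂ N V) {u : MonoidAlgebra ℤ H} (hu : u ∈ Subring.center _)
    (huN : SupportedOnCoset (1 : H ⧸ N) u) {θ : ℂ}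
    (hθ : ∑ g : N, u.coeff (g : H) • ρ g = θ • 1) {f : H → V}
    (hf : ∀ (g : N) x, f (g * x) = ρ g (f x)) :
    MonoidAlgebra.lift ℤ (Module.End ℂ (H → V)) H (rightTranslation H V) u f = θ • f := by
  ext x
  rw [lift_rightTranslation_apply, sum_eq_sum_subgroup N huN (fun h => f (x * h)), Pi.smul_apply]
  have hθx := congrArg (fun T : Module.End ℂ V => T (f x)) hθ
  simp only [LinearMap.sum_apply, LinearMap.smul_apply, Module.End.one_apply] at hθx
  rw [← hθx]
  -- Equivariance reads `x * g` as `(x * g * x⁻¹) * x`, and `u` has the same coefficient at `g` and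
  -- at its conjugate.
  refine Fintype.sum_equiv (MulAut.conjNormal x : MulAut N).toEquiv _ _ fun g => ?_
  change _ = u.coeff ((MulAut.conjNormal x g : N) : H) • ρ (MulAut.conjNormal x g) (f x)
  rw [← hf, MulAut.conjNormal_apply, coeff_conj_of_mem_center hu, inv_mul_cancel_right]

/-- Project onto the `ζ`-eigenspace by averaging over powers of `z`, starting from the equivariant
function supported on `N` with value `v` at `1`. -/
theorem exists_mem_coinducedEigenspace {N : Subgroup H} [N.Normal] [Fintype N]
    (ρ : Representation ℂ N V) {z : MonoidAlgebra ℤ H} (hz : z ∈ Subring.center _) {t : H ⧸ N}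
    (hzt : SupportedOnCoset t z) {ζ : ℂ} (hζ : ζ ≠ 0)
    (hθ : ∑ g : N, (z ^ orderOf t).coeff (g : H) • ρ g = ζ ^ orderOf t • 1) (v : V) :
    ∃ f ∈ coinducedEigenspace ρ z ζ, f 1 = v := by
  classical
  set Z := MonoidAlgebra.lift ℤ (Module.End ℂ (H → V)) H (rightTranslation H V) z with hZ
  set m := orderOf t with hm
  have hm0 : 0 < m := orderOf_pos t
  let f₀ : H → V := fun x => if hx : x ∈ N then ρ ⟨x, hx⟩ v else 0
  have hf₀ : ∀ (g : N) x, f₀ (g * x) = ρ g (f₀ x) := by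
    intro g x
    by_cases hx : x ∈ N
    · have hgx : (g : H) * x ∈ N := N.mul_mem g.2 hx
      simp only [f₀, dif_pos hx, dif_pos hgx]
      rw [← Module.End.mul_apply, ← map_mul]
      rfl
    · have hgx : (g : H) * x ∉ N := fun h => hx ((N.mul_mem_cancel_left g.2).mp h)
      simp only [f₀, dif_neg hx, dif_neg hgx, map_zero]
  have hpow : ∀ i : ℕ, Z ^ i =
      MonoidAlgebra.lift ℤ (Module.End ℂ (H → V)) H (rightTranslation H V) (z ^ i) :=
    fun i => (map_pow _ z i).symm
  have hZm : (Z ^ m) f₀ = ζ ^ m • f₀ := by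
    rw [hpow]
    refine lift_rightTranslation_eq_smul ρ (pow_mem hz m) ?_ hθ hf₀
    have := hzt.pow m
    rwa [hm, pow_orderOf_eq_one] at this
  refine ⟨∑ i ∈ Finset.range m, (ζ ^ i)⁻¹ • (Z ^ i) f₀, ⟨?_, ?_⟩, ?_⟩
  · intro g x
    simp only [Finset.sum_apply, Pi.smul_apply, map_sum, map_smul]
    refine Finset.sum_congr rfl fun i _ => ?_
    simp only [hpow, lift_rightTranslation_apply, mul_assoc, hf₀, map_sum, map_zsmul]
  · change Z _ = _
    have hstep : ∀ i, Z ((ζ ^ i)⁻¹ • (Z ^ i) f₀) =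
        ζ • ((ζ ^ (i + 1))⁻¹ • (Z ^ (i + 1)) f₀) := by
      intro i
      rw [map_smul, ← Module.End.mul_apply, ← pow_succ', smul_smul]
      congr 1
      rw [pow_succ, mul_inv, mul_left_comm, mul_inv_cancel₀ hζ, mul_one]
    rw [map_sum, Finset.sum_congr rfl fun i _ => hstep i, ← Finset.smul_sum]
    congr 1
    -- Applying `Z` shifts the sum by one index, and the term at `m` equals the term at `0`.
    have h1 := Finset.sum_range_succ (fun i => (ζ ^ i)⁻¹ • (Z ^ i) f₀) m
    rw [Finset.sum_range_succ', hZm, smul_smul, inv_mul_cancel₀ (pow_ne_zero _ hζ)] at h1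
    simpa using h1
  · rw [Finset.sum_apply, Finset.sum_eq_single_of_mem 0 (Finset.mem_range.mpr hm0)]
    · simp only [pow_zero, inv_one, one_smul, Module.End.one_apply, f₀, dif_pos N.one_mem]
      exact congrArg (fun T : Module.End ℂ V => T v) (map_one ρ)
    -- For `0 < i < m`, `z ^ i` lives on a nontrivial coset, where `f₀` vanishes.
    · intro i hi hi0
      rw [Pi.smul_apply, hpow, lift_rightTranslation_apply, Finset.sum_eq_zero, smul_zero]
      intro h _
      by_cases h0 : (z ^ i).coeff h = 0
      · rw [h0, zero_smul]
      · have hh := hzt.pow i h h0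
        have : h ∉ N := by
          intro hN
          rw [(QuotientGroup.eq_one_iff h).mpr hN] at hh
          exact pow_ne_one_of_lt_orderOf hi0 (Finset.mem_range.mp hi) hh.symm
        simp only [one_mul, f₀, dif_neg this, smul_zero]

/-- By equivariance `f` vanishes on `N`. The eigenvalue equation expresses `f x` through values of
`f` on the coset `x t`, so vanishing spreads from coset to coset. -/
theorem eq_zero_of_mem_coinducedEigenspace {N : Subgroup H} [N.Normal]
    (ρ : Representation ℂ N V) {z : MonoidAlgebra ℤ H} {t : H ⧸ N}
    (hzt : SupportedOnCoset t z) (ht : ∀ s : H ⧸ N, ∃ j : ℕ, s * t ^ j = 1) {ζ : ℂ} (hζ : ζ ≠ 0)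
    {f : H → V} (hf : f ∈ coinducedEigenspace ρ z ζ) (hf1 : f 1 = 0) : f = 0 := by
  have key : ∀ (i : ℕ) (x : H), (x : H ⧸ N) * t ^ i = 1 → f x = 0 := by
    intro i
    induction i with
    | zero =>
      intro x hx
      rw [pow_zero, mul_one] at hx
      have := hf.1 ⟨x, (QuotientGroup.eq_one_iff x).mp hx⟩ 1
      rwa [hf1, map_zero, mul_one] at this
    | succ i ih =>
      intro x hx
      have h1 := congrFun hf.2 x
      rw [lift_rightTranslation_apply, Finset.sum_eq_zero, Pi.smul_apply] at h1
      · exact (smul_eq_zero.mp h1.symm).resolve_left hζ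
      · intro h _
        by_cases h0 : z.coeff h = 0
        · rw [h0, zero_smul]
        · rw [ih (x * h), smul_zero]
          rw [QuotientGroup.mk_mul, hzt h h0, mul_assoc, ← pow_succ', hx]
  ext x
  obtain ⟨j, hj⟩ := ht x
  exact key j x hj

/-- Evaluation at `1` identifies the eigenspace with `V`, and right translation is transported along
it. -/
theorem exists_extension {N : Subgroup H} [N.Normal] [Fintype N]
    (ρ : Representation ℂ N V) {z : MonoidAlgebra ℤ H} (hz : z ∈ Subring.center _) {t : H ⧸ N}
    (hzt : SupportedOnCoset t z) (ht : ∀ s : H ⧸ N, ∃ j : ℕ, s * t ^ j = 1) {ζ : ℂ} (hζ : ζ ≠ 0)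
    (hθ : ∑ g : N, (z ^ orderOf t).coeff (g : H) • ρ g = ζ ^ orderOf t • 1) :
    ∃ σ : Representation ℂ H V, (∀ g : N, σ g = ρ g) ∧
      MonoidAlgebra.lift ℤ (Module.End ℂ V) H σ z = ζ • 1 := by
  let S : Subrepresentation (rightTranslation H V) :=
    { toSubmodule := coinducedEigenspace ρ z ζ
      apply_mem_toSubmodule := by
        rintro h f ⟨hf, hf'⟩
        refine ⟨fun g x => ?_, ?_⟩
        · rw [rightTranslation_apply, mul_assoc, hf, rightTranslation_apply]
        · have := congrArg
            (MonoidAlgebra.lift ℤ (Module.End ℂ (H → V)) H (rightTranslation H V))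
            (Subring.mem_center_iff.mp hz (MonoidAlgebra.single h 1))
          rw [map_mul, map_mul, MonoidAlgebra.lift_single, one_smul] at this
          rw [← Module.End.mul_apply, ← this, Module.End.mul_apply, hf', map_smul] }
  let ev : S.toSubmodule →ₗ[ℂ] V := LinearMap.proj 1 ∘ₗ S.toSubmodule.subtype
  have hev : ∀ f, ev f = (f : H → V) 1 := fun _ => rfl
  have hbij : Function.Bijective ev := by
    refine ⟨(injective_iff_map_eq_zero ev).mpr fun f hf => ?_, fun v => ?_⟩
    · exact Subtype.ext (eq_zero_of_mem_coinducedEigenspace ρ hzt ht hζ f.2 hf)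
    · obtain ⟨f, hf, hfv⟩ := exists_mem_coinducedEigenspace ρ hz hzt hζ hθ v
      exact ⟨⟨f, hf⟩, hfv⟩
  let e := LinearEquiv.ofBijective ev hbij
  let σ : Representation ℂ H V :=
    { toFun := fun h => e.conj (S.toRepresentation h)
      map_one' := by rw [map_one]; exact e.conj_id
      map_mul' := fun a b => by rw [map_mul]; exact e.conj_comp _ _ }
  have hσ : ∀ h v, σ h v = (e.symm v : H → V) h := by
    intro h v
    change (e.symm v : H → V) (1 * h) = _
    rw [one_mul]
  have hone : ∀ v, (e.symm v : H → V) 1 = v := fun v => e.apply_symm_apply v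
  refine ⟨σ, fun g => ?_, ?_⟩
  · ext v
    rw [hσ, ← mul_one (g : H), (e.symm v).2.1 g 1, hone]
  · ext v
    rw [lift_apply_vector]
    have := congrFun (e.symm v).2.2 1
    rw [lift_rightTranslation_apply, Pi.smul_apply, hone] at this
    simpa [hσ] using this

end Extension

/-! ### Galois action on character values -/

section Galois

/-- The exponent `k` records how the automorphism acts on the `|H|`-th roots of unity, of which
character values are sums. -/
theorem exists_coprime_pow_character {H V : Type*} [Group H] [Finite H] [AddCommGroup V]
    [Module ℂ V] [FiniteDimensional ℂ V] (ρ : Representation ℂ H V) (F : IntermediateField ℚ ℂ)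
    (σ : Gal(algebraicClosure F ℂ/F)) :
    ∃ k : ℕ, (Nat.card H).Coprime k ∧ ∀ h, ∃ x : algebraicClosure F ℂ,
      (x : ℂ) = ρ.character h ∧ (σ x : ℂ) = ρ.character (h ^ k) := by
  have hN : Nat.card H ≠ 0 := Nat.card_pos.ne'
  have : NeZero (Nat.card H) := ⟨hN⟩
  have hμ := Complex.isPrimitiveRoot_exp (Nat.card H) hN
  have halg : ∀ x : ℂ, x ^ Nat.card H = 1 → x ∈ algebraicClosure F ℂ := fun x hx =>
    mem_algebraicClosure_iff.mpr (IsIntegral.isAlgebraic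
      (IsIntegral.of_pow (Nat.pos_of_ne_zero hN) (hx ▸ isIntegral_one)))
  obtain ⟨μ, hμ⟩ : ∃ μ : algebraicClosure F ℂ, IsPrimitiveRoot μ (Nat.card H) :=
    ⟨⟨_, halg _ hμ.pow_eq_one⟩, IsPrimitiveRoot.of_map_of_injective
      (f := (algebraicClosure F ℂ).val) hμ Subtype.val_injective⟩
  obtain ⟨k, -, hk, hσk⟩ := (hμ.isPrimitiveRoot_iff).mp (hμ.map_of_injective σ.injective)
  have hσ : ∀ x : algebraicClosure F ℂ, x ^ Nat.card H = 1 → σ x = x ^ k := by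
    intro x hx
    obtain ⟨i, -, rfl⟩ := hμ.eq_pow_of_pow_eq_one hx
    rw [map_pow, ← hσk, ← pow_mul, ← pow_mul, mul_comm]
  refine ⟨k, hk.symm, fun h => ?_⟩
  obtain ⟨s, d, hs, hd⟩ := exists_trace_pow_eq_sum (T := ρ h) hN
    (by rw [← map_pow, pow_card_eq_one', map_one])
  refine ⟨∑ x : s, d x * ⟨x, halg x (hs x x.2)⟩, ?_, ?_⟩
  · have := hd 1
    rw [pow_one] at this
    rw [Representation.character, this, ← Finset.sum_coe_sort s]
    simp
  · rw [Representation.character, map_pow, hd, ← Finset.sum_coe_sort s, map_sum]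
    simp only [map_mul, map_natCast]
    push_cast
    refine Finset.sum_congr rfl fun x _ => ?_
    rw [hσ _ (Subtype.ext (hs x x.2))]
    simp

end Galois

/-! ### Sizes of conjugacy classes -/

section ConjugacyClasses

variable {H : Type*} [Group H]

/-- The `k`-th power map is a bijection of `H` commuting with conjugation. -/
theorem card_conjugatesOf_pow {k : ℕ} (hk : (Nat.card H).Coprime k) (c : H) :
    Nat.card (conjugatesOf (c ^ k)) = Nat.card (conjugatesOf c) := by
  have : conjugatesOf (c ^ k) = powCoprime hk '' conjugatesOf c := by
    ext x
    simp only [conjugatesOf, Set.mem_ofPred_eq, Set.mem_image, isConj_iff, powCoprime_apply]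
    constructor
    · rintro ⟨h, rfl⟩
      exact ⟨h * c * h⁻¹, ⟨h, rfl⟩, conj_pow⟩
    · rintro ⟨_, ⟨h, rfl⟩, rfl⟩
      exact ⟨h, conj_pow.symm⟩
  rw [this, Nat.card_image_of_injective (powCoprime hk).injective]

theorem card_conjugatesOf_dvd_index {c : H} {Q : Subgroup H}
    (hc : c ∈ Subgroup.centralizer (Q : Set H)) : Nat.card (conjugatesOf c) ∣ Q.index := by
  have h1 : Nat.card (conjugatesOf c) =
      (MulAction.stabilizer (ConjAct H) c).index := by
    rw [MulAction.index_stabilizer, ConjAct.orbit_eq_carrier_conjClasses]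
    rfl
  have h2 : Q.map (ConjAct.toConjAct : H ≃* ConjAct H).toMonoidHom ≤
      MulAction.stabilizer (ConjAct H) c := by
    rintro _ ⟨q, hq, rfl⟩
    rw [MulAction.mem_stabilizer_iff]
    change q * c * q⁻¹ = c
    rw [Subgroup.mem_centralizer_iff.mp hc q hq, mul_inv_cancel_right]
  rw [h1, ← Subgroup.index_map_equiv Q (ConjAct.toConjAct : H ≃* ConjAct H)]
  exact Subgroup.index_dvd_of_le h2

end ConjugacyClasses

/-! ### The extension in the principal block and its character field -/

theorem exists_extension_centralChar_sub_mem {H V : Type*} [Group H] [Fintype H]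
    [AddCommGroup V] [Module ℂ V] [FiniteDimensional ℂ V] {N : Subgroup H} [N.Normal] [Fintype N]
    [IsCyclic (H ⧸ N)] {M : Ideal (integralClosure ℤ ℂ)} [M.IsPrime] (ρ : Representation ℂ N V)
    [ρ.IsIrreducible] (hχ : SameBlock M ρ.character (fun _ => 1)) {c : H}
    (hc : ∀ s : H ⧸ N, ∃ j : ℕ, s * (c : H ⧸ N) ^ j = 1)
    (hcM : (Nat.card (conjugatesOf c) : integralClosure ℤ ℂ) ∉ M) :
    ∃ (σ : Representation ℂ H V) (ζ : integralClosure ℤ ℂ), (∀ g : N, σ g = ρ g) ∧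
      MonoidAlgebra.lift ℤ (Module.End ℂ V) H σ (classSum c) = (ζ : ℂ) • 1 ∧
      ζ - (Nat.card (conjugatesOf c) : integralClosure ℤ ℂ) ∈ M ∧
      (ζ : ℂ) ^ orderOf (c : H ⧸ N) ∈ characterField ρ.character := by
  set m := orderOf (c : H ⧸ N) with hm
  have hsupp : SupportedOnCoset (c : H ⧸ N) (classSum c) := supportedOnCoset_classSum c
  obtain ⟨θ, hθ, hθF, hθM⟩ := exists_centralChar_sub_augmentation_mem N ρ hχ
    (pow_mem (classSum_mem_center c) m) (by simpa [hm, pow_orderOf_eq_one] using hsupp.pow m)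
  rw [map_pow, augmentation_classSum] at hθM
  push_cast at hθM
  obtain ⟨ζ, rfl, hζM⟩ := exists_root_sub_mem (orderOf_pos (c : H ⧸ N)).ne' hθM
  have hζ : (ζ : ℂ) ≠ 0 := by
    intro h
    rw [ZeroMemClass.coe_eq_zero] at h
    rw [h, zero_sub, neg_mem_iff] at hζM
    exact hcM hζM
  push_cast at hθ hθF
  obtain ⟨σ, hσ, hσζ⟩ := exists_extension ρ (classSum_mem_center c) hsupp hc hζ hθ
  exact ⟨σ, ζ, hσ, hσζ, hζM, hθF⟩

/-- The extension lies in the principal block: multiplying a class sum by a power of that of `c`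
brings it into `N`, where the hypothesis on `ρ` applies, and the extra factor is invertible modulo
`M`. -/
theorem centralChar_sub_card_mem {H V : Type*} [Group H] [Fintype H]
    [AddCommGroup V] [Module ℂ V] [FiniteDimensional ℂ V] {N : Subgroup H} [N.Normal] [Fintype N]
    [IsCyclic (H ⧸ N)] {M : Ideal (integralClosure ℤ ℂ)} [M.IsPrime] (ρ : Representation ℂ N V)
    [ρ.IsIrreducible] (hχ : SameBlock M ρ.character (fun _ => 1)) {c : H}
    (hc : ∀ s : H ⧸ N, ∃ j : ℕ, s * (c : H ⧸ N) ^ j = 1)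
    (hcM : (Nat.card (conjugatesOf c) : integralClosure ℤ ℂ) ∉ M)
    {σ : Representation ℂ H V} {ζ : integralClosure ℤ ℂ} (hσ : ∀ g : N, σ g = ρ g)
    (hσζ : MonoidAlgebra.lift ℤ (Module.End ℂ V) H σ (classSum c) = (ζ : ℂ) • 1)
    (hζM : ζ - (Nat.card (conjugatesOf c) : integralClosure ℤ ℂ) ∈ M)
    {b : H} {η : integralClosure ℤ ℂ}
    (hη : MonoidAlgebra.lift ℤ (Module.End ℂ V) H σ (classSum b) = (η : ℂ) • 1) :
    η - (Nat.card (conjugatesOf b) : integralClosure ℤ ℂ) ∈ M := by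
  obtain ⟨j, hj⟩ := hc b
  have hsupp : SupportedOnCoset (1 : H ⧸ N) (classSum b * classSum c ^ j) := by
    rw [← hj]
    exact (supportedOnCoset_classSum b).mul ((supportedOnCoset_classSum c).pow j)
  obtain ⟨θ, hθ, -, hθM⟩ := exists_centralChar_sub_augmentation_mem N ρ hχ
    (mul_mem (classSum_mem_center b) (pow_mem (classSum_mem_center c) j)) hsupp
  have hd := finrank_ne_zero_of_isIrreducible ρ
  have : Nontrivial V := by
    rw [← Module.finrank_pos_iff (R := ℂ)]
    exact Nat.pos_of_ne_zero (Nat.cast_ne_zero.mp hd)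
  have hmul : η * ζ ^ j = θ := by
    have h1 : MonoidAlgebra.lift ℤ (Module.End ℂ V) H σ (classSum b * classSum c ^ j) =
        (θ : ℂ) • 1 := by
      rw [← hθ, lift_eq_sum, sum_eq_sum_subgroup N hsupp (fun h => σ h)]
      simp only [hσ]
    rw [map_mul, map_pow, hη, hσζ, smul_pow, one_pow, smul_mul_smul_comm, one_mul] at h1
    exact Subtype.ext (smul_left_injective ℂ (one_ne_zero (α := Module.End ℂ V)) h1)
  rw [map_mul, map_pow, augmentation_classSum, augmentation_classSum, ← hmul] at hθM
  push_cast at hθM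
  rw [← Ideal.Quotient.eq] at hθM hζM ⊢
  rw [map_mul, map_mul, map_pow, map_pow, hζM] at hθM
  refine mul_right_cancel₀ (pow_ne_zero j ?_) hθM
  rwa [Ne, Ideal.Quotient.eq_zero_iff_mem]

/-- An element of an algebraic extension that is fixed by the Galois group of the algebraic closure
lies in the base field. -/
theorem mem_of_forall_galois_fixed (F : IntermediateField ℚ ℂ) (x : algebraicClosure F ℂ)
    (hx : ∀ σ : Gal(algebraicClosure F ℂ/F), σ x = x) : (x : ℂ) ∈ F := by
  have : IsAlgClosed (algebraicClosure F ℂ) := IsAlgClosure.isAlgClosed F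
  have : IsGalois F (algebraicClosure F ℂ) := {}
  obtain ⟨y, rfl⟩ := (InfiniteGalois.mem_range_algebraMap_iff_fixed x).mpr hx
  exact y.2

theorem centralChar_mem_characterField {H V : Type*} [Group H] [Fintype H]
    [AddCommGroup V] [Module ℂ V] [FiniteDimensional ℂ V] {N : Subgroup H} [N.Normal] [Fintype N]
    [IsCyclic (H ⧸ N)] {M : Ideal (integralClosure ℤ ℂ)} [M.IsPrime] (ρ : Representation ℂ N V)
    [ρ.IsIrreducible] (hχ : SameBlock M ρ.character (fun _ => 1)) {c : H}
    (hc : ∀ s : H ⧸ N, ∃ j : ℕ, s * (c : H ⧸ N) ^ j = 1)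
    (hcM : (Nat.card (conjugatesOf c) : integralClosure ℤ ℂ) ∉ M)
    (hmM : (orderOf (c : H ⧸ N) : integralClosure ℤ ℂ) ∉ M)
    {σ : Representation ℂ H V} {ζ : integralClosure ℤ ℂ} (hσ : ∀ g : N, σ g = ρ g)
    (hσζ : MonoidAlgebra.lift ℤ (Module.End ℂ V) H σ (classSum c) = (ζ : ℂ) • 1)
    (hζM : ζ - (Nat.card (conjugatesOf c) : integralClosure ℤ ℂ) ∈ M)
    (hζF : (ζ : ℂ) ^ orderOf (c : H ⧸ N) ∈ characterField ρ.character) :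
    (ζ : ℂ) ∈ characterField ρ.character := by
  set F := characterField ρ.character
  have := isIrreducible_of_extension ρ σ hσ
  have hd := finrank_ne_zero_of_isIrreducible ρ
  have hζalg : (ζ : ℂ) ∈ algebraicClosure F ℂ :=
    mem_algebraicClosure_iff.mpr (IsIntegral.isAlgebraic (IsIntegral.tower_top ζ.2))
  refine mem_of_forall_galois_fixed F ⟨ζ, hζalg⟩ fun τ => ?_
  obtain ⟨k, hk, hτ⟩ := exists_coprime_pow_character σ F τ
  obtain ⟨x, hx, hτx⟩ := hτ c
  obtain ⟨η, hη⟩ := exists_lift_eq_smul_one σ (classSum_mem_center (c ^ k))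
  have hζd := centralChar_mul_finrank σ hσζ
  have hηd := centralChar_mul_finrank σ hη
  have hτζ : (τ ⟨ζ, hζalg⟩ : ℂ) = η := by
    have h1 : (⟨ζ, hζalg⟩ : algebraicClosure F ℂ) * (Module.finrank ℂ V : ℕ) =
        (Nat.card (conjugatesOf c) : ℕ) * x := by
      apply Subtype.ext
      push_cast
      rw [hx]
      exact hζd
    have h2 := congrArg (fun y => ((τ y : algebraicClosure F ℂ) : ℂ)) h1
    simp only [map_mul, map_natCast] at h2
    push_cast at h2
    rw [hτx, ← card_conjugatesOf_pow hk c, ← hηd] at h2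
    exact mul_right_cancel₀ hd h2
  have hpow : η ^ orderOf (c : H ⧸ N) = (ζ : ℂ) ^ orderOf (c : H ⧸ N) := by
    have h1 := τ.commutes ⟨_, hζF⟩
    have h2 : algebraMap F (algebraicClosure F ℂ) ⟨_, hζF⟩ =
        (⟨ζ, hζalg⟩ : algebraicClosure F ℂ) ^ orderOf (c : H ⧸ N) := Subtype.ext rfl
    rw [h2, map_pow] at h1
    have h3 := congrArg (Subtype.val : algebraicClosure F ℂ → ℂ) h1
    push_cast at h3
    rwa [hτζ] at h3
  -- Integrality is needed before `η` can be compared with `ζ` modulo `M`.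
  have hηi : IsIntegral ℤ η := by
    refine IsIntegral.of_pow (orderOf_pos (c : H ⧸ N)) ?_
    rw [hpow]
    exact IsIntegral.pow ζ.2 _
  have hηM := centralChar_sub_card_mem ρ hχ hc hcM hσ hσζ hζM (η := ⟨η, hηi⟩) hη
  rw [card_conjugatesOf_pow hk c] at hηM
  have hζnot : ζ ∉ M := fun h => hcM (by simpa using sub_mem h hζM)
  have heq : (⟨η, hηi⟩ : integralClosure ℤ ℂ) = ζ :=
    eq_of_pow_eq_of_sub_mem hmM hζnot (by simpa using sub_mem hηM hζM) (Subtype.ext hpow)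
  apply Subtype.ext
  rw [hτζ]
  exact congrArg Subtype.val heq

theorem characterField_extension_eq {H V : Type*} [Group H] [Fintype H]
    [AddCommGroup V] [Module ℂ V] [FiniteDimensional ℂ V] {N : Subgroup H} [N.Normal] [Fintype N]
    [IsCyclic (H ⧸ N)] (ρ : Representation ℂ N V) {c : H}
    (hc : ∀ s : H ⧸ N, ∃ j : ℕ, s * (c : H ⧸ N) ^ j = 1)
    {σ : Representation ℂ H V} {ζ : ℂ} (hσ : ∀ g : N, σ g = ρ g)
    (hσζ : MonoidAlgebra.lift ℤ (Module.End ℂ V) H σ (classSum c) = ζ • 1)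
    (hζ : ζ ≠ 0) (hζF : ζ ∈ characterField ρ.character) :
    characterField σ.character = characterField ρ.character := by
  have hres : ∀ g : N, σ.character g = ρ.character g := fun g => by
    simp only [Representation.character, hσ]
  apply le_antisymm
  · refine IntermediateField.adjoin_le_iff.mpr ?_
    rintro _ ⟨h, rfl⟩
    obtain ⟨j, hj⟩ := hc h
    -- This product acts as `ζ ^ j • σ h`, yet involves only elements of `N`, so its trace is an
    -- integral combination of values of `ρ.character`.
    have hsupp : SupportedOnCoset (1 : H ⧸ N) (MonoidAlgebra.single h 1 * classSum c ^ j) := by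
      rw [← hj]
      exact (SupportedOnCoset.single h 1).mul ((supportedOnCoset_classSum c).pow j)
    have h1 : MonoidAlgebra.lift ℤ (Module.End ℂ V) H σ
        (MonoidAlgebra.single h 1 * classSum c ^ j) = ζ ^ j • σ h := by
      rw [map_mul, map_pow, hσζ, MonoidAlgebra.lift_single, one_smul, smul_pow, one_pow,
        mul_smul_comm, mul_one]
    rw [lift_eq_sum, sum_eq_sum_subgroup N hsupp (fun h => σ h)] at h1
    have h2 := congrArg (LinearMap.trace ℂ V) h1
    rw [map_sum, map_smul, smul_eq_mul] at h2
    have h3 : σ.character h = (ζ ^ j)⁻¹ * ∑ g : N,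
        ((MonoidAlgebra.single h 1 * classSum c ^ j : MonoidAlgebra ℤ H).coeff (g : H) : ℂ) *
          ρ.character g := by
      rw [eq_inv_mul_iff_mul_eq₀ (pow_ne_zero j hζ)]
      refine h2.symm.trans (Finset.sum_congr rfl fun g _ => ?_)
      rw [map_zsmul, zsmul_eq_mul, ← hres]
      rfl
    rw [SetLike.mem_coe, h3]
    exact mul_mem (inv_mem (pow_mem hζF j)) (sum_mem fun g _ => mul_mem (intCast_mem _ _)
      (IntermediateField.subset_adjoin _ _ ⟨g, rfl⟩))
  · refine IntermediateField.adjoin_le_iff.mpr ?_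
    rintro _ ⟨g, rfl⟩
    exact IntermediateField.subset_adjoin _ _ ⟨(g : H), hres g⟩

theorem natCast_notMem_of_not_dvd {A : Type*} [CommRing A] {M : Ideal A} (hM : M ≠ ⊤) {ℓ : ℕ}
    (hℓ : ℓ.Prime) (hℓM : (ℓ : A) ∈ M) {n : ℕ} (hn : ¬ ℓ ∣ n) : (n : A) ∉ M := by
  intro hnM
  obtain ⟨a, b, hab⟩ := Nat.isCoprime_iff_coprime.mpr ((Nat.Prime.coprime_iff_not_dvd hℓ).mpr hn)
  apply hM
  rw [Ideal.eq_top_iff_one]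
  have : (1 : A) = (a : A) * (ℓ : A) + (b : A) * (n : A) := by
    simpa using (congrArg (Int.cast : ℤ → A) hab).symm
  rw [this]
  exact add_mem (M.mul_mem_left _ hℓM) (M.mul_mem_left _ hnM)

theorem mainTheorem9 {Ghat : Type*} [Group Ghat] [Finite Ghat]
    (G : Subgroup Ghat) [G.Normal] (hcyc : IsCyclic (Ghat ⧸ G))
    (ℓ : ℕ) (hℓ : ℓ.Prime) (hindex : ¬ ℓ ∣ G.index)
    (M : Ideal (integralClosure ℤ ℂ)) (hM : M.IsMaximal) (hℓM : (ℓ : integralClosure ℤ ℂ) ∈ M)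
    (P : Sylow ℓ G)
    (hP : (G : Set Ghat) *
      (Subgroup.centralizer ((P : Subgroup G).map G.subtype : Set Ghat) : Set Ghat) = Set.univ)
    (χ : G → ℂ) (hχ : InPrincipalBlock M χ) :
    ∃ χhat : Ghat → ℂ, IsIrrChar χhat ∧ (∀ g : G, χhat g = χ g) ∧
      characterField χhat = characterField χ := by
  obtain ⟨⟨n, ρ, hρ, rfl⟩, hblock⟩ := hχ
  have := hM.isPrime
  have : Fact ℓ.Prime := ⟨hℓ⟩
  have := Fintype.ofFinite Ghat
  have := Fintype.ofFinite G
  obtain ⟨c, hcP, hgen⟩ : ∃ c ∈ Subgroup.centralizer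
      ((P : Subgroup G).map G.subtype : Set Ghat),
      ∀ s : Ghat ⧸ G, s ∈ Subgroup.zpowers (c : Ghat ⧸ G) := by
    obtain ⟨t, ht⟩ := hcyc.exists_generator
    obtain ⟨x, rfl⟩ := QuotientGroup.mk_surjective t
    obtain ⟨g, hg, c, hc, rfl⟩ := Set.mem_mul.mp (hP ▸ Set.mem_univ x)
    refine ⟨c, hc, ?_⟩
    rwa [QuotientGroup.mk_mul, (QuotientGroup.eq_one_iff g).mpr hg, one_mul] at ht
  have hc : ∀ s : Ghat ⧸ G, ∃ j : ℕ, s * (c : Ghat ⧸ G) ^ j = 1 := by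
    intro s
    obtain ⟨j, hj⟩ := (mem_powers_iff_mem_zpowers (G := Ghat ⧸ G)).mpr (hgen s⁻¹)
    exact ⟨j, by simp only at hj; rw [hj, mul_inv_cancel]⟩
  have horder : orderOf (c : Ghat ⧸ G) = G.index := orderOf_eq_card_of_forall_mem_zpowers hgen
  have hcard : ¬ ℓ ∣ Nat.card (conjugatesOf c) := by
    intro hdvd
    -- The index of `P` in `Ghat` is `|G : P|` times `|Ghat : G|`, both prime to `ℓ`.
    have h1 := hdvd.trans (card_conjugatesOf_dvd_index hcP)
    rw [Subgroup.index_map_subtype, hℓ.dvd_mul] at h1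
    exact h1.elim P.not_dvd_index hindex
  have hcM := natCast_notMem_of_not_dvd hM.ne_top hℓ hℓM hcard
  have hmM := natCast_notMem_of_not_dvd hM.ne_top hℓ hℓM hindex
  rw [← horder] at hmM
  obtain ⟨σ, ζ, hσ, hσζ, hζM, hζF⟩ := exists_extension_centralChar_sub_mem ρ hblock hc hcM
  have hζ : (ζ : ℂ) ≠ 0 := by
    intro h
    rw [ZeroMemClass.coe_eq_zero] at h
    rw [h, zero_sub, neg_mem_iff] at hζM
    exact hcM hζM
  refine ⟨σ.character, ⟨n, σ, isIrreducible_of_extension ρ σ hσ, rfl⟩, fun g => ?_, ?_⟩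
  · simp only [Representation.character, hσ]
  · exact characterField_extension_eq ρ hc hσ hσζ hζ
      (centralChar_mem_characterField ρ hblock hc hcM hmM hσ hσζ hζM hζF)
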